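/- Consider a network of $N$ sensors with nodes $\mathcal V=\{1,\dots,N\}$ and weight matrix $\mathcal L=[l_{ij}]\in\mathbb R^{N\times N}$, which is doubly stochastic (non-negative entries, all row and column sums equal to $1$) with positive diagonal entries. Its directed graph, with an edge $(i,j)$ iff $l_{ij}>0$, is assumed strongly connected; let $d$ be its diameter (the largest directed distance between two nodes). Let $A\in\mathbb R^{n\times n}$, let $Q\in\mathbb R^{n\times n}$ be symmetric positive definite, and for each $j\in\mathcal V$ let $C_j\in\mathbb R^{n_j\times n}$ and let $R_j\in\mathbb R^{n_j\times n_j}$ be symmetric positive definite. Put $C=[C_1^T,\dots,C_N^T]^T$ and $R=\operatorname{diag}(R_1,\dots,R_N)$, and assume that $(A,C)$ is observable, i.e. the matrix with block rows $C,CA,\dots,CA^{n-1}$ has rank $n$. For $L\ge 0$ let $l_{ij}^{(L)}$ be the $(i,j)$ entry of $\mathcal L^L$, and for $i\in\mathcal V$ put $$\tilde C_i^{(L)}=\big[\operatorname{sign}(l_{i1}^{(L)})C_1^T,\dots,\operatorname{sign}(l_{iN}^{(L)})C_N^T\big]^T,\qquad \tilde R_i^{(L)}=\operatorname{diag}\Big(\tfrac{1}{Nl_{i1}^{(L)}}R_1,\dots,\tfrac{1}{Nl_{iN}^{(L)}}R_N\Big),$$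 where $\operatorname{sign}(0)=0$ and $\tfrac{1}{Nl_{ij}^{(L)}}$ is read as $0$ if $l_{ij}^{(L)}=0$. Then the discrete-time algebraic Riccati equation $$P=APA^T+Q-APC^T(CPC^T+R)^{-1}CPA^T$$ has exactly one symmetric positive semidefinite solution $P$, and for every $i\in\mathcal V$ and every $L\ge d$ the equation obtained from it by replacing $(C,R)$ with $(\tilde C_i^{(L)},\tilde R_i^{(L)})$ has exactly one symmetric positive semidefinite solution $P_i^{(L)}$. Moreover, there are constants $M_1>0$ and $0<q_1<1$ (depending on $A,C,Q,R$ and $\mathcal L$, but not on $i$ or $L$) such that $$\big\|P-P_i^{(L)}\big\|_2\le M_1q_1^L\qquad\text{for all } i\in\mathcal V \text{ and all } L\ge d,$$ where $\|\cdot\|_2$ is the matrix 2-norm (largest singular value). -/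

import Mathlib

open scoped Matrix
-- `‖M‖` for a matrix `M` is the 2-norm (largest singular value).
open scoped Matrix.Norms.L2Operator

noncomputable section

namespace CMFusion

/-! ### The communication graph -/

/-- `(i, j)` is an edge (sensor `i` receives from sensor `j`) iff the weight `l i j` is positive. -/
def Edge {N : ℕ} (W : Matrix (Fin N) (Fin N) ℝ) (i j : Fin N) : Prop := 0 < W i j

/-- There is a directed walk with exactly `k` edges from `i` to `j`. -/
def HasWalk {N : ℕ} (W : Matrix (Fin N) (Fin N) ℝ) : ℕ → Fin N → Fin N → Prop
  | 0, i, j => i = j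
  | k + 1, i, j => ∃ h, Edge W i h ∧ HasWalk W k h j

/-- Every node can be reached from every node along directed edges. -/
def StronglyConnected {N : ℕ} (W : Matrix (Fin N) (Fin N) ℝ) : Prop :=
  ∀ i j, ∃ k, HasWalk W k i j

/-- Directed distance: length of a shortest directed walk (for strongly connected graphs). -/
def graphDist {N : ℕ} (W : Matrix (Fin N) (Fin N) ℝ) (i j : Fin N) : ℕ :=
  sInf {k | HasWalk W k i j}

/-- Diameter: the largest directed distance between two nodes. -/
def graphDiam {N : ℕ} (W : Matrix (Fin N) (Fin N) ℝ) : ℕ :=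
  Finset.univ.sup fun p : Fin N × Fin N => graphDist W p.1 p.2

/-! ### Observability and the Riccati equation -/

/-- Kalman rank condition: the observability matrix with block rows
`C, C A, …, C A ^ (n - 1)` has rank `n`. -/
def Observable {n : ℕ} {p : Type*} (A : Matrix (Fin n) (Fin n) ℝ)
    (C : Matrix p (Fin n) ℝ) : Prop :=
  (Matrix.of fun (r : Fin n × p) (x : Fin n) => (C * A ^ (r.1 : ℕ)) r.2 x).rank = n

/-- `P` is a (symmetric) positive semidefinite solution of the discrete-time algebraic Riccati
equation with data `(A, C, Q, R)`. -/
def IsDareSolution {n : ℕ} {p : Type*} [Fintype p] [DecidableEq p]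
    (A : Matrix (Fin n) (Fin n) ℝ) (C : Matrix p (Fin n) ℝ)
    (Q : Matrix (Fin n) (Fin n) ℝ) (R : Matrix p p ℝ) (P : Matrix (Fin n) (Fin n) ℝ) : Prop :=
  P.PosSemidef ∧
    P = A * P * Aᵀ + Q - A * P * Cᵀ * (C * P * Cᵀ + R)⁻¹ * C * P * Aᵀ

/-! ### Sensor network -/

/-- The collective observation matrix, stacking `C₁, …, C_N`. -/
def stackedC {N n : ℕ} {m : Fin N → ℕ} (C : ∀ j, Matrix (Fin (m j)) (Fin n) ℝ) :
    Matrix (Σ j, Fin (m j)) (Fin n) ℝ :=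
  Matrix.of fun r x => C r.1 r.2 x

/-- The collective noise covariance `diag (R₁, …, R_N)`. -/
def collectiveR {N : ℕ} {m : Fin N → ℕ} (R : ∀ j, Matrix (Fin (m j)) (Fin (m j)) ℝ) :
    Matrix (Σ j, Fin (m j)) (Σ j, Fin (m j)) ℝ :=
  Matrix.blockDiagonal' R

/-- The modified observation matrix of node `i` after `L` fusion steps, stacking
`sign (l_{ij}^{(L)}) C_j`, where `l_{ij}^{(L)}` is the `(i, j)` entry of `W ^ L`. -/
def modifiedC {N n : ℕ} {m : Fin N → ℕ} (W : Matrix (Fin N) (Fin N) ℝ)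
    (C : ∀ j, Matrix (Fin (m j)) (Fin n) ℝ) (L : ℕ) (i : Fin N) :
    Matrix (Σ j, Fin (m j)) (Fin n) ℝ :=
  stackedC fun j => Real.sign ((W ^ L) i j) • C j

/-- The mismatched noise covariance of node `i` after `L` fusion steps,
`diag (R_j / (N l_{ij}^{(L)}))`, where `1 / 0` is read as `0`. -/
def modifiedR {N : ℕ} {m : Fin N → ℕ} (W : Matrix (Fin N) (Fin N) ℝ)
    (R : ∀ j, Matrix (Fin (m j)) (Fin (m j)) ℝ) (L : ℕ) (i : Fin N) :
    Matrix (Σ j, Fin (m j)) (Σ j, Fin (m j)) ℝ :=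
  Matrix.blockDiagonal' fun j => (1 / ((N : ℝ) * (W ^ L) i j)) • R j

end CMFusion

end

/-!
For `L` at least the diameter all weights `l = (W ^ L) i j` are positive: walks can be prolonged by
self-loops. Hence the modified observation matrix is the collective one, and the two Riccati
equations differ only in the noise covariance, whose blocks are rescaled by `1 / (N l)`. By
Doeblin's argument these factors tend to `1` geometrically (`exists_pow_apply_sub_le`), so there is
`s = 1 + O(q ^ L)` such that each of the two covariances is at most `s` times the other in the
Loewner order.

The core is a comparison principle (`riccati_fixedPoint_le_smul`): if `R ≤ t R'` with `t ≥ 1`, then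
the solutions satisfy `P ≤ t P'`. It rests on the fact that the Riccati map is the minimum over all
gains of the affine map `josephMap`, and on a Lyapunov argument for the closed loop of the optimal
gain (`nonneg_of_conj_le`). With `t = 1` it gives uniqueness; with `t = s`, used in both directions,
it gives `P ≤ s P'` and `P' ≤ s P`, and thus `‖P - P'‖ = O(s - 1)`, uniformly in `i` and `L`
because the bound involves only `P`. No continuity of the solution in `R` is needed.

Existence (`Observable.exists_riccati_fixedPoint`) follows by iterating the Riccati map from `0`.
The iterates increase. They are bounded because they are the costs of a linear-quadratic control
problem for the dual system, which observability makes steerable to zero in `n` steps.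
-/

namespace CMFusion

/-! ### The Riccati map and comparison of its fixed points -/

section Riccati

open Matrix Filter Topology
open scoped MatrixOrder

theorem smul_loewner_le {n : Type*} [Fintype n] {X Y : Matrix n n ℝ} (h : X ≤ Y)
    {s : ℝ} (hs : 0 ≤ s) : s • X ≤ s • Y := by
  rw [Matrix.le_iff] at h ⊢
  rw [← smul_sub]
  exact h.smul hs

theorem conj_loewner_le {m n : Type*} [Fintype n] [Fintype m] {X Y : Matrix n n ℝ} (h : X ≤ Y)
    (F : Matrix m n ℝ) : F * X * Fᵀ ≤ F * Y * Fᵀ := by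
  rw [Matrix.le_iff] at h ⊢
  simpa [Matrix.mul_sub, Matrix.sub_mul, conjTranspose_eq_transpose_of_trivial]
    using h.mul_mul_conjTranspose_same F

theorem loewner_le_iff_dotProduct {n : Type*} [Fintype n] {X Y : Matrix n n ℝ}
    (hX : Xᵀ = X) (hY : Yᵀ = Y) : X ≤ Y ↔ ∀ v, v ⬝ᵥ X *ᵥ v ≤ v ⬝ᵥ Y *ᵥ v := by
  rw [Matrix.le_iff, posSemidef_iff_dotProduct_mulVec]
  have h : (Y - X).IsHermitian := by
    rw [IsHermitian, conjTranspose_eq_transpose_of_trivial, transpose_sub, hX, hY]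
  simp only [h, true_and, star_trivial, sub_mulVec, dotProduct_sub, sub_nonneg]

theorem transpose_eq_of_posSemidef {n : Type*} [Fintype n] {X : Matrix n n ℝ}
    (h : X.PosSemidef) : Xᵀ = X := by
  simpa [IsHermitian, conjTranspose_eq_transpose_of_trivial] using h.isHermitian

/-- A positive definite matrix is an order unit for the Loewner order: the quotient of the two
quadratic forms is bounded on the unit sphere, by compactness, and it is homogeneous of degree
zero. -/
theorem exists_le_smul_posDef {n : Type*} [Fintype n] {X B : Matrix n n ℝ}
    (hX : Xᵀ = X) (hB : B.PosDef) : ∃ c : ℝ, 1 ≤ c ∧ X ≤ c • B := by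
  have hBt := transpose_eq_of_posSemidef hB.posSemidef
  have hK : IsCompact (Metric.sphere (0 : n → ℝ) 1) := isCompact_sphere _ _
  have hcont : ContinuousOn (fun v : n → ℝ => (v ⬝ᵥ X *ᵥ v) / (v ⬝ᵥ B *ᵥ v))
      (Metric.sphere 0 1) := by
    refine ContinuousOn.div ?_ ?_ ?_
    · exact Continuous.continuousOn (by fun_prop)
    · exact Continuous.continuousOn (by fun_prop)
    · intro v hv
      have hv0 : v ≠ 0 := by
        rintro rfl
        simp at hv
      simpa using (hB.dotProduct_mulVec_pos hv0).ne'
  obtain ⟨c, hc⟩ := hK.bddAbove_image hcont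
  refine ⟨max c 1, le_max_right _ _, ?_⟩
  rw [loewner_le_iff_dotProduct hX (by rw [transpose_smul, hBt])]
  intro v
  by_cases hv : v = 0
  · simp [hv]
  have hpos : 0 < v ⬝ᵥ B *ᵥ v := by simpa using hB.dotProduct_mulVec_pos hv
  have hn : 0 < ‖v‖ := norm_pos_iff.2 hv
  have h1 := hc ⟨‖v‖⁻¹ • v, by simp [norm_smul, hn.ne'], rfl⟩
  simp only [mulVec_smul, dotProduct_smul, smul_dotProduct, smul_eq_mul] at h1
  rw [mul_div_mul_left _ _ (inv_ne_zero hn.ne'), mul_div_mul_left _ _ (inv_ne_zero hn.ne'),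
    div_le_iff₀ hpos] at h1
  rw [smul_mulVec, dotProduct_smul, smul_eq_mul]
  exact h1.trans (mul_le_mul_of_nonneg_right (le_max_left _ _) hpos.le)

/-- The inequality `F X Fᵀ + Q ≤ X` with `Q` positive definite is a Lyapunov certificate that `F`
is stable: it gives `F X Fᵀ ≤ r X` for some `r < 1`. If `F D Fᵀ ≤ D`, then iterating a bound
`-D ≤ c X` yields `-D ≤ c r ^ k X` for all `k`, so that `D` is nonnegative. -/
theorem nonneg_of_conj_le {n : Type*} [Fintype n] {F D X Q : Matrix n n ℝ} (hQ : Q.PosDef)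
    (hX : X.PosSemidef) (hFX : F * X * Fᵀ + Q ≤ X) (hD : Dᵀ = D) (hFD : F * D * Fᵀ ≤ D) :
    0 ≤ D := by
  have hXt := transpose_eq_of_posSemidef hX
  -- `X ≥ Q` because `F X Fᵀ` is positive semidefinite.
  have hXpd : X.PosDef := by
    have h1 : (F * X * Fᵀ).PosSemidef := by
      simpa [conjTranspose_eq_transpose_of_trivial] using hX.mul_mul_conjTranspose_same F
    have h2 : X = (F * X * Fᵀ + Q) + (X - (F * X * Fᵀ + Q)) := by abel
    rw [h2]
    exact (PosDef.posSemidef_add h1 hQ).add_posSemidef (Matrix.le_iff.1 hFX)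
  obtain ⟨b, hb1, hb⟩ := exists_le_smul_posDef hXt hQ
  obtain ⟨c, hc1, hc⟩ := exists_le_smul_posDef (X := -D) (by rw [transpose_neg, hD]) hXpd
  have hb0 : 0 < b := by linarith
  have hcontr : F * X * Fᵀ ≤ (1 - b⁻¹) • X := by
    have h1 : b⁻¹ • X ≤ Q := by
      have := smul_loewner_le hb (inv_nonneg.2 hb0.le)
      rwa [smul_smul, inv_mul_cancel₀ hb0.ne', one_smul] at this
    rw [sub_smul, one_smul, le_sub_iff_add_le]
    exact (add_le_add_right h1 _).trans hFX
  have hr0 : 0 ≤ 1 - b⁻¹ := by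
    have := inv_le_one_of_one_le₀ hb1
    linarith
  have hr1 : 1 - b⁻¹ < 1 := by
    have := inv_pos.2 hb0
    linarith
  have hk : ∀ k : ℕ, -D ≤ (c * (1 - b⁻¹) ^ k) • X := by
    intro k
    induction k with
    | zero => simpa using hc
    | succ k ih =>
      calc -D ≤ F * (-D) * Fᵀ := by simpa using hFD
        _ ≤ F * ((c * (1 - b⁻¹) ^ k) • X) * Fᵀ := conj_loewner_le ih F
        _ = (c * (1 - b⁻¹) ^ k) • (F * X * Fᵀ) := by simp
        _ ≤ (c * (1 - b⁻¹) ^ k) • ((1 - b⁻¹) • X) :=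
            smul_loewner_le hcontr (mul_nonneg (by linarith) (pow_nonneg hr0 k))
        _ = _ := by rw [smul_smul, pow_succ, mul_assoc]
  have hlim : Tendsto (fun k : ℕ => c * (1 - b⁻¹) ^ k) atTop (𝓝 (c * 0)) :=
    (tendsto_pow_atTop_nhds_zero_of_lt_one hr0 hr1).const_mul c
  rw [mul_zero] at hlim
  rw [← neg_nonpos, loewner_le_iff_dotProduct (by rw [transpose_neg, hD]) transpose_zero]
  intro v
  have h2 : Tendsto (fun k : ℕ => c * (1 - b⁻¹) ^ k * (v ⬝ᵥ X *ᵥ v)) atTop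
      (𝓝 (0 * (v ⬝ᵥ X *ᵥ v))) :=
    hlim.mul_const _
  rw [zero_mul] at h2
  simp only [zero_mulVec, dotProduct_zero]
  refine ge_of_tendsto' h2 fun k => ?_
  have h3 := (loewner_le_iff_dotProduct (by rw [transpose_neg, hD])
    (by rw [transpose_smul, hXt])).1 (hk k) v
  rwa [smul_mulVec, dotProduct_smul, smul_eq_mul] at h3

variable {n p : Type*} [Fintype n] [Fintype p]
  {A Q P P' : Matrix n n ℝ} {C : Matrix p n ℝ} {R R' : Matrix p p ℝ} {K : Matrix n p ℝ}

/-- The Joseph form of one step of the Riccati recursion: the error covariance after one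
prediction step from the covariance `P` when the observer gain is `K`. It is affine and monotone
in `P` and in `R`. -/
def josephMap (A : Matrix n n ℝ) (C : Matrix p n ℝ) (Q : Matrix n n ℝ) (R : Matrix p p ℝ)
    (K : Matrix n p ℝ) (P : Matrix n n ℝ) : Matrix n n ℝ :=
  (A - K * C) * P * (A - K * C)ᵀ + K * R * Kᵀ + Q

theorem josephMap_posSemidef (hQ : Q.PosSemidef) (hP : P.PosSemidef) (hR : R.PosDef)
    (K : Matrix n p ℝ) : (josephMap A C Q R K P).PosSemidef := by
  refine (PosSemidef.add ?_ ?_).add hQ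
  · simpa [conjTranspose_eq_transpose_of_trivial] using hP.mul_mul_conjTranspose_same (A - K * C)
  · simpa [conjTranspose_eq_transpose_of_trivial] using hR.posSemidef.mul_mul_conjTranspose_same K

theorem posDef_innovation (hP : P.PosSemidef) (hR : R.PosDef) : (C * P * Cᵀ + R).PosDef := by
  refine PosDef.posSemidef_add ?_ hR
  simpa [conjTranspose_eq_transpose_of_trivial] using hP.mul_mul_conjTranspose_same C

variable [DecidableEq p]

/-- The right-hand side of the Riccati equation, as a map of `P`. Its fixed points are the
solutions of the equation. -/
noncomputable def riccatiMap (A : Matrix n n ℝ) (C : Matrix p n ℝ) (Q : Matrix n n ℝ)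
    (R : Matrix p p ℝ) (P : Matrix n n ℝ) : Matrix n n ℝ :=
  A * P * Aᵀ + Q - A * P * Cᵀ * (C * P * Cᵀ + R)⁻¹ * C * P * Aᵀ

/-- The Kalman gain, which minimizes `josephMap` over all gains in the Loewner order. -/
noncomputable def kalmanGain (A : Matrix n n ℝ) (C : Matrix p n ℝ) (R : Matrix p p ℝ)
    (P : Matrix n n ℝ) : Matrix n p ℝ :=
  A * P * Cᵀ * (C * P * Cᵀ + R)⁻¹

/-- Completion of squares in the gain `K`. -/
theorem josephMap_eq (hP : P.PosSemidef) (hR : R.PosDef) :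
    josephMap A C Q R K P = riccatiMap A C Q R P +
      (K - kalmanGain A C R P) * (C * P * Cᵀ + R) * (K - kalmanGain A C R P)ᵀ := by
  have hS := posDef_innovation (C := C) hP hR
  have hPt := transpose_eq_of_posSemidef hP
  have hSt := transpose_eq_of_posSemidef hS.posSemidef
  have hdet : IsUnit (C * P * Cᵀ + R).det := (Matrix.isUnit_iff_isUnit_det _).1 hS.isUnit
  have hJ : josephMap A C Q R K P = A * P * Aᵀ + Q - K * (C * P * Aᵀ) - A * P * Cᵀ * Kᵀ
      + K * (C * P * Cᵀ + R) * Kᵀ := by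
    simp only [josephMap, transpose_sub, transpose_mul, Matrix.sub_mul, Matrix.mul_sub,
      Matrix.mul_add, Matrix.add_mul, Matrix.mul_assoc]
    abel
  rw [hJ, riccatiMap, kalmanGain]
  generalize C * P * Cᵀ + R = S at *
  have h1 : S * S⁻¹ = 1 := mul_nonsing_inv _ hdet
  have h2 : S⁻¹ * S = 1 := nonsing_inv_mul _ hdet
  have h3 : (K - A * P * Cᵀ * S⁻¹) * S = K * S - A * P * Cᵀ := by
    rw [Matrix.sub_mul, Matrix.mul_assoc (A * P * Cᵀ), h2, Matrix.mul_one]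
  have h4 : (K - A * P * Cᵀ * S⁻¹)ᵀ = Kᵀ - S⁻¹ * (C * P * Aᵀ) := by
    simp only [transpose_sub, transpose_mul, transpose_nonsing_inv, hSt, hPt, transpose_transpose,
      Matrix.mul_assoc]
  have h5 : K * S * (S⁻¹ * (C * P * Aᵀ)) = K * (C * P * Aᵀ) := by
    rw [Matrix.mul_assoc K, ← Matrix.mul_assoc S, h1, Matrix.one_mul]
  rw [h3, h4, Matrix.sub_mul, Matrix.mul_sub, Matrix.mul_sub, h5]
  simp only [Matrix.mul_assoc]
  abel

theorem riccatiMap_eq_josephMap (hP : P.PosSemidef) (hR : R.PosDef) :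
    riccatiMap A C Q R P = josephMap A C Q R (kalmanGain A C R P) P := by
  simp [josephMap_eq hP hR]

theorem riccatiMap_le_josephMap (hP : P.PosSemidef) (hR : R.PosDef) (K : Matrix n p ℝ) :
    riccatiMap A C Q R P ≤ josephMap A C Q R K P := by
  rw [josephMap_eq hP hR, Matrix.le_iff, add_sub_cancel_left]
  simpa [conjTranspose_eq_transpose_of_trivial] using
    (posDef_innovation hP hR).posSemidef.mul_mul_conjTranspose_same (K - kalmanGain A C R P)

theorem riccatiMap_posSemidef (hQ : Q.PosSemidef) (hP : P.PosSemidef) (hR : R.PosDef) :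
    (riccatiMap A C Q R P).PosSemidef := by
  rw [riccatiMap_eq_josephMap hP hR]
  exact josephMap_posSemidef hQ hP hR _

theorem riccatiMap_mono (hP : P.PosSemidef) (hP' : P'.PosSemidef) (hR : R.PosDef) (h : P ≤ P') :
    riccatiMap A C Q R P ≤ riccatiMap A C Q R P' := by
  rw [riccatiMap_eq_josephMap hP' hR]
  refine (riccatiMap_le_josephMap hP hR (kalmanGain A C R P')).trans ?_
  exact add_le_add_left (add_le_add_left (conj_loewner_le h _) _) _

/-- Comparison of the solutions of two Riccati equations that differ in the noise covariance. Let
`K` be the optimal gain of the second equation and `F = A - K C`. Since `K` is suboptimal for the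
first equation, `D = t P' - P` satisfies
`D ≥ F D Fᵀ + K (t R' - R) Kᵀ + (t - 1) Q ≥ F D Fᵀ`,
and `F` is stable because `P' ≥ F P' Fᵀ + Q`. The case `t = 1` gives uniqueness. -/
theorem riccati_fixedPoint_le_smul (hQ : Q.PosDef) (hR : R.PosDef) (hR' : R'.PosDef)
    (hP : P.PosSemidef) (hP' : P'.PosSemidef)
    (h : P = riccatiMap A C Q R P) (h' : P' = riccatiMap A C Q R' P')
    {t : ℝ} (ht : 1 ≤ t) (hRR : R ≤ t • R') : P ≤ t • P' := by
  set K := kalmanGain A C R' P'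
  set F := A - K * C
  have hJ' : P' = F * P' * Fᵀ + K * R' * Kᵀ + Q := h'.trans (riccatiMap_eq_josephMap hP' hR')
  have hJ : P ≤ F * P * Fᵀ + K * R * Kᵀ + Q := by
    conv_lhs => rw [h]
    exact riccatiMap_le_josephMap hP hR K
  have hKR' : 0 ≤ K * R' * Kᵀ := by
    simpa using conj_loewner_le (Matrix.nonneg_iff_posSemidef.2 hR'.posSemidef) K
  rw [← sub_nonneg]
  refine nonneg_of_conj_le (F := F) hQ hP' ?_ ?_ ?_
  · conv_rhs => rw [hJ']
    refine add_le_add_left ?_ _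
    simpa using add_le_add_right hKR' (F * P' * Fᵀ)
  · rw [transpose_sub, transpose_smul, transpose_eq_of_posSemidef hP,
      transpose_eq_of_posSemidef hP']
  · have e1 : t • P' = t • (F * P' * Fᵀ) + t • (K * R' * Kᵀ) + t • Q := by
      conv_lhs => rw [hJ']
      simp only [smul_add]
    have e2 : K * R * Kᵀ ≤ t • (K * R' * Kᵀ) := by
      simpa using conj_loewner_le hRR K
    have e3 : Q ≤ t • Q := by
      rw [Matrix.le_iff]
      have : t • Q - Q = (t - 1) • Q := by rw [sub_smul, one_smul]
      rw [this]
      exact hQ.posSemidef.smul (by linarith)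
    have e4 : F * (t • P' - P) * Fᵀ = t • (F * P' * Fᵀ) - F * P * Fᵀ := by
      simp [Matrix.mul_sub, Matrix.sub_mul]
    rw [e4, e1, le_sub_iff_add_le, sub_add_eq_add_sub, sub_le_iff_le_add]
    calc t • (F * P' * Fᵀ) + P ≤ t • (F * P' * Fᵀ) + (F * P * Fᵀ + K * R * Kᵀ + Q) :=
          add_le_add_right hJ _
      _ ≤ t • (F * P' * Fᵀ) + (F * P * Fᵀ + t • (K * R' * Kᵀ) + t • Q) := by gcongr
      _ = _ := by abel

end Riccati

/-! ### Existence of a fixed point under observability -/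

section Existence

open Matrix Filter Topology
open scoped MatrixOrder

theorem dotProduct_mulVec_add_le {n : Type*} [Fintype n] {X : Matrix n n ℝ} (hX : X.PosSemidef)
    (v w : n → ℝ) :
    (v + w) ⬝ᵥ X *ᵥ (v + w) ≤ 2 * (v ⬝ᵥ X *ᵥ v) + 2 * (w ⬝ᵥ X *ᵥ w) := by
  have h := hX.dotProduct_mulVec_nonneg (v - w)
  simp only [star_trivial, mulVec_sub, mulVec_add, dotProduct_add, dotProduct_sub, add_dotProduct,
    sub_dotProduct] at h ⊢
  linarith

theorem dotProduct_conj_mulVec {m n : Type*} [Fintype m] [Fintype n] (F : Matrix m n ℝ)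
    (X : Matrix n n ℝ) (v : m → ℝ) :
    v ⬝ᵥ (F * X * Fᵀ) *ᵥ v = (Fᵀ *ᵥ v) ⬝ᵥ X *ᵥ (Fᵀ *ᵥ v) := by
  rw [← mulVec_mulVec, ← mulVec_mulVec, dotProduct_mulVec, ← mulVec_transpose]

/-- The directions `v` in which the quadratic forms of the sequence `X` of positive semidefinite
matrices stay bounded. They form a subspace. -/
def boundedDirections {n : Type*} [Fintype n] (X : ℕ → Matrix n n ℝ)
    (hX : ∀ k, (X k).PosSemidef) :
    Submodule ℝ (n → ℝ) where
  carrier := {v | ∃ b : ℝ, ∀ k, v ⬝ᵥ X k *ᵥ v ≤ b}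
  zero_mem' := ⟨0, fun k => by simp⟩
  add_mem' := by
    rintro v w ⟨b, hb⟩ ⟨c, hc⟩
    refine ⟨2 * b + 2 * c, fun k => (dotProduct_mulVec_add_le (hX k) v w).trans ?_⟩
    linarith [hb k, hc k]
  smul_mem' := by
    rintro s v ⟨b, hb⟩
    refine ⟨s * s * b, fun k => ?_⟩
    simp only [mulVec_smul, dotProduct_smul, smul_dotProduct, smul_eq_mul, ← mul_assoc]
    exact mul_le_mul_of_nonneg_left (hb k) (mul_self_nonneg s)

/-- Observability of `(A, C)` is reachability of the dual system `(Aᵀ, Cᵀ)`: the transpose of the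
observability matrix is onto. -/
theorem Observable.exists_pow_mulVec_eq_sum {n : ℕ} {p : Type*} [Fintype p]
    {A : Matrix (Fin n) (Fin n) ℝ} {C : Matrix p (Fin n) ℝ} (h : Observable A C) (w : Fin n → ℝ) :
    ∃ u : ℕ → p → ℝ, w = ∑ i ∈ Finset.range n, (Aᵀ ^ i) *ᵥ (Cᵀ *ᵥ u i) := by
  classical
  set O : Matrix (Fin n × p) (Fin n) ℝ :=
    Matrix.of fun (r : Fin n × p) (x : Fin n) => (C * A ^ (r.1 : ℕ)) r.2 x with hO
  have hr : Oᵀ.rank = n := by rw [rank_transpose]; exact h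
  have htop : LinearMap.range Oᵀ.mulVecLin = ⊤ := by
    apply Submodule.eq_top_of_finrank_eq
    rw [← Matrix.rank, hr]
    simp
  obtain ⟨z, hz⟩ : w ∈ LinearMap.range Oᵀ.mulVecLin := htop ▸ Submodule.mem_top
  refine ⟨fun i q => if hi : i < n then z (⟨i, hi⟩, q) else 0, ?_⟩
  rw [← hz, Finset.sum_range]
  ext x
  simp only [mulVecLin_apply, mulVec_mulVec, ← transpose_pow, ← transpose_mul, Finset.sum_apply]
  simp only [mulVec, dotProduct, Fintype.sum_prod_type, transpose_apply, hO, Matrix.of_apply,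
    Fin.is_lt, dite_true, Fin.eta]

variable {n : ℕ} {p : Type*} [Fintype p]

/-- A state `v` of the dual system `v ↦ Aᵀ v - Cᵀ u` that controls steer to zero in `k` steps lies
in every subspace that contains each state having a successor in it. The controls are applied in
the order `u (k - 1), …, u 0`. -/
theorem mem_of_pow_mulVec_eq_sum {A : Matrix (Fin n) (Fin n) ℝ}
    {C : Matrix p (Fin n) ℝ} {V : Submodule ℝ (Fin n → ℝ)}
    (hV : ∀ v u, Aᵀ *ᵥ v - Cᵀ *ᵥ u ∈ V → v ∈ V) (k : ℕ) :
    ∀ (v : Fin n → ℝ) (u : ℕ → p → ℝ),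
      (Aᵀ ^ k) *ᵥ v = ∑ i ∈ Finset.range k, (Aᵀ ^ i) *ᵥ (Cᵀ *ᵥ u i) → v ∈ V := by
  induction k with
  | zero =>
    intro v u h
    have : v = 0 := by simpa using h
    simp [this]
  | succ k ih =>
    intro v u h
    refine hV v (u k) (ih _ u ?_)
    rw [Finset.sum_range_succ, ← sub_eq_iff_eq_add] at h
    rw [← h, mulVec_sub, mulVec_mulVec, pow_succ]

variable [DecidableEq p]

/-- The Bellman inequality of the dual linear-quadratic control problem: `v ↦ vᵀ P v` is a cost to
go, and one step of the Riccati recursion costs at most what any control `u` costs. -/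
theorem riccatiMap_dotProduct_le {A Q P : Matrix (Fin n) (Fin n) ℝ} {C : Matrix p (Fin n) ℝ}
    {R : Matrix p p ℝ} (hP : P.PosSemidef) (hQ : Q.PosSemidef) (hR : R.PosDef)
    (v : Fin n → ℝ) (u : p → ℝ) :
    v ⬝ᵥ riccatiMap A C Q R P *ᵥ v ≤
      (Aᵀ *ᵥ v - Cᵀ *ᵥ u) ⬝ᵥ P *ᵥ (Aᵀ *ᵥ v - Cᵀ *ᵥ u) + u ⬝ᵥ R *ᵥ u + v ⬝ᵥ Q *ᵥ v := by
  by_cases hv : v = 0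
  · have h1 := hP.dotProduct_mulVec_nonneg (Cᵀ *ᵥ u)
    have h2 := hR.posSemidef.dotProduct_mulVec_nonneg u
    simp only [star_trivial] at h1 h2
    simp only [hv, mulVec_zero, zero_sub, mulVec_neg, neg_dotProduct, dotProduct_neg, neg_neg,
      dotProduct_zero, add_zero]
    exact add_nonneg h1 h2
  -- `K` is the rank-one gain with `Kᵀ v = u`.
  have hvv : v ⬝ᵥ v ≠ 0 := fun h => hv (dotProduct_self_eq_zero.1 h)
  set K : Matrix (Fin n) p ℝ := vecMulVec ((v ⬝ᵥ v)⁻¹ • v) u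
  have hK : Kᵀ *ᵥ v = u := by
    rw [transpose_vecMulVec, vecMulVec_mulVec, smul_dotProduct, smul_eq_mul, inv_mul_cancel₀ hvv]
    simp
  have h1 := (loewner_le_iff_dotProduct
    (transpose_eq_of_posSemidef (riccatiMap_posSemidef hQ hP hR))
    (transpose_eq_of_posSemidef (josephMap_posSemidef hQ hP hR K))).1
    (riccatiMap_le_josephMap (A := A) (C := C) (Q := Q) hP hR K) v
  refine h1.trans_eq ?_
  have hF : (A - K * C)ᵀ *ᵥ v = Aᵀ *ᵥ v - Cᵀ *ᵥ u := by
    rw [transpose_sub, transpose_mul, sub_mulVec, ← mulVec_mulVec, hK]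
  rw [josephMap, add_mulVec, add_mulVec, dotProduct_add, dotProduct_add,
    dotProduct_conj_mulVec, dotProduct_conj_mulVec, hF, hK]

/-- Convergence of all quadratic forms gives convergence of the matrices, by polarization. -/
theorem tendsto_of_tendsto_dotProduct {X : ℕ → Matrix (Fin n) (Fin n) ℝ}
    (hX : ∀ k, (X k)ᵀ = X k)
    (h : ∀ v : Fin n → ℝ, ∃ l, Tendsto (fun k => v ⬝ᵥ X k *ᵥ v) atTop (𝓝 l)) :
    ∃ Y, Tendsto X atTop (𝓝 Y) := by
  choose l hl using h
  let e : Fin n → Fin n → ℝ := fun i => Pi.single i 1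
  have hpol : ∀ k i j, X k i j = ((e i + e j) ⬝ᵥ X k *ᵥ (e i + e j) - e i ⬝ᵥ X k *ᵥ e i
      - e j ⬝ᵥ X k *ᵥ e j) / 2 := by
    intro k i j
    have hs : X k j i = X k i j := congrFun (congrFun (hX k) i) j
    simp only [e, mulVec_add, dotProduct_add, add_dotProduct, single_one_dotProduct,
      mulVec_single_one, col_apply, hs]
    ring
  refine ⟨Matrix.of fun i j => (l (e i + e j) - l (e i) - l (e j)) / 2, ?_⟩
  refine tendsto_pi_nhds.2 fun i => tendsto_pi_nhds.2 fun j => ?_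
  simp only [hpol, Matrix.of_apply]
  exact (((hl _).sub (hl _)).sub (hl _)).div_const 2

/-- The Riccati recursion started at `0` increases, and observability bounds it: the dual state can
be steered to zero in `n` steps, which bounds the cost from every direction. Its limit is a fixed
point. -/
theorem Observable.exists_riccati_fixedPoint {A Q : Matrix (Fin n) (Fin n) ℝ}
    {C : Matrix p (Fin n) ℝ} {R : Matrix p p ℝ} (hQ : Q.PosSemidef) (hR : R.PosDef)
    (hobs : Observable A C) :
    ∃ P : Matrix (Fin n) (Fin n) ℝ, P.PosSemidef ∧ P = riccatiMap A C Q R P := by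
  set f := riccatiMap A C Q R with hf
  let X : ℕ → Matrix (Fin n) (Fin n) ℝ := fun k => f^[k] 0
  have hXs : ∀ k, X (k + 1) = f (X k) := fun k => Function.iterate_succ_apply' f k 0
  have hX : ∀ k, (X k).PosSemidef := by
    intro k
    induction k with
    | zero => exact PosSemidef.zero
    | succ k ih => rw [hXs]; exact riccatiMap_posSemidef hQ ih hR
  have hXt := fun k => transpose_eq_of_posSemidef (hX k)
  have hmono : Monotone X := by
    refine monotone_nat_of_le_succ fun k => ?_
    induction k with
    | zero => exact Matrix.nonneg_iff_posSemidef.2 (hX 1)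
    | succ k ih =>
      rw [hXs, hXs (k + 1)]
      exact riccatiMap_mono (hX k) (hX (k + 1)) hR ih
  have hback : ∀ v u, Aᵀ *ᵥ v - Cᵀ *ᵥ u ∈ boundedDirections X hX → v ∈ boundedDirections X hX := by
    rintro v u ⟨b, hb⟩
    refine ⟨max 0 (b + u ⬝ᵥ R *ᵥ u + v ⬝ᵥ Q *ᵥ v), fun k => ?_⟩
    cases k with
    | zero => simp [X]
    | succ k =>
      rw [hXs]
      refine (riccatiMap_dotProduct_le (hX k) hQ hR v u).trans (le_max_of_le_right ?_)
      gcongr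
      exact hb k
  have hlim : ∀ v : Fin n → ℝ, ∃ l, Tendsto (fun k => v ⬝ᵥ X k *ᵥ v) atTop (𝓝 l) := by
    intro v
    obtain ⟨u, hu⟩ := hobs.exists_pow_mulVec_eq_sum ((Aᵀ ^ n) *ᵥ v)
    obtain ⟨b, hb⟩ : v ∈ boundedDirections X hX := mem_of_pow_mulVec_eq_sum hback n v u hu
    refine ⟨_, tendsto_atTop_ciSup (fun i j hij => ?_) ⟨b, ?_⟩⟩
    · exact (loewner_le_iff_dotProduct (hXt i) (hXt j)).1 (hmono hij) v
    · rintro _ ⟨k, rfl⟩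
      exact hb k
  obtain ⟨P, hP⟩ := tendsto_of_tendsto_dotProduct hXt hlim
  have hPpsd : P.PosSemidef := by
    refine PosSemidef.of_dotProduct_mulVec_nonneg ?_ fun v => ?_
    · rw [IsHermitian, conjTranspose_eq_transpose_of_trivial]
      refine tendsto_nhds_unique (((continuous_id.matrix_transpose).tendsto P).comp hP) ?_
      refine hP.congr fun k => (hXt k).symm
    · have hc : Continuous fun Y : Matrix (Fin n) (Fin n) ℝ => star v ⬝ᵥ Y *ᵥ v := by fun_prop
      exact ge_of_tendsto' ((hc.tendsto P).comp hP) fun k => (hX k).dotProduct_mulVec_nonneg v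
  refine ⟨P, hPpsd, ?_⟩
  have hinv : ContinuousAt (fun Y : Matrix (Fin n) (Fin n) ℝ => (C * Y * Cᵀ + R)⁻¹) P := by
    have hdet : (C * P * Cᵀ + R).det ≠ 0 :=
      ((Matrix.isUnit_iff_isUnit_det _).1 (posDef_innovation hPpsd hR).isUnit).ne_zero
    have h1 : ContinuousAt (Inv.inv : Matrix p p ℝ → Matrix p p ℝ) (C * P * Cᵀ + R) := by
      refine continuousAt_matrix_inv _ ?_
      rw [Ring.inverse_eq_inv']
      exact continuousAt_inv₀ hdet
    exact ContinuousAt.comp (f := fun Y : Matrix (Fin n) (Fin n) ℝ => C * Y * Cᵀ + R) h1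
      (by fun_prop)
  have hcont : ContinuousAt f P := by
    have hg : Continuous fun Z : Matrix (Fin n) (Fin n) ℝ × Matrix p p ℝ =>
        A * Z.1 * Aᵀ + Q - A * Z.1 * Cᵀ * Z.2 * C * Z.1 * Aᵀ := by fun_prop
    exact ContinuousAt.comp (f := fun Y : Matrix (Fin n) (Fin n) ℝ => (Y, (C * Y * Cᵀ + R)⁻¹))
      hg.continuousAt (continuousAt_id.prodMk hinv)
  refine tendsto_nhds_unique (f := fun k => X (k + 1)) ((tendsto_add_atTop_iff_nat 1).2 hP) ?_
  simp only [hXs]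
  exact hcont.tendsto.comp hP

end Existence

/-! ### Powers of the weight matrix -/

section Consensus

variable {N : ℕ} {W : Matrix (Fin N) (Fin N) ℝ}

theorem HasWalk.pow_pos (hW : W ∈ doublyStochastic ℝ (Fin N)) {k : ℕ} :
    ∀ {i j : Fin N}, HasWalk W k i j → 0 < (W ^ k) i j := by
  induction k with
  | zero => rintro i _ rfl; simp
  | succ k ih =>
    rintro i j ⟨h, h1, h2⟩
    rw [pow_succ', Matrix.mul_apply]
    exact Finset.sum_pos'
      (fun x _ => mul_nonneg (nonneg_of_mem_doublyStochastic hW)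
        (nonneg_of_mem_doublyStochastic (pow_mem hW k)))
      ⟨h, Finset.mem_univ h, mul_pos h1 (ih h2)⟩

/-- Walks can be prolonged by waiting at their first node, which has a self-loop. -/
theorem HasWalk.of_le (hdiag : ∀ i, 0 < W i i) {k L : ℕ} (hkL : k ≤ L) {i j : Fin N}
    (h : HasWalk W k i j) : HasWalk W L i j := by
  induction L, hkL using Nat.le_induction with
  | base => exact h
  | succ L _ ih => exact ⟨i, hdiag i, ih⟩

theorem StronglyConnected.hasWalk (hconn : StronglyConnected W) (hdiag : ∀ i, 0 < W i i)
    {L : ℕ} (hL : graphDiam W ≤ L) (i j : Fin N) : HasWalk W L i j := by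
  have h1 : HasWalk W (graphDist W i j) i j := Nat.sInf_mem (hconn i j)
  have h2 : graphDist W i j ≤ graphDiam W :=
    Finset.le_sup (f := fun p : Fin N × Fin N => graphDist W p.1 p.2) (Finset.mem_univ (i, j))
  exact h1.of_le hdiag (h2.trans hL)

/-- An entrywise lower bound on `W ^ d` passes to all later powers, as the columns of `W ^ k` are
convex weights. -/
theorem exists_pow_apply_lower_bound (hW : W ∈ doublyStochastic ℝ (Fin N)) {d : ℕ}
    (hd : ∀ i j, 0 < (W ^ d) i j) :
    ∃ δ : ℝ, 0 < δ ∧ δ ≤ 1 / 2 ∧ ∀ L, d ≤ L → ∀ i j, δ ≤ (W ^ L) i j := by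
  obtain ⟨δ, hδ0, hδ⟩ : ∃ δ : ℝ, 0 < δ ∧ ∀ i j, δ ≤ (W ^ d) i j := by
    cases isEmpty_or_nonempty (Fin N) with
    | inl h => exact ⟨1, one_pos, fun i => isEmptyElim i⟩
    | inr h =>
      obtain ⟨p, hp⟩ := Finite.exists_min fun p : Fin N × Fin N => (W ^ d) p.1 p.2
      exact ⟨_, hd p.1 p.2, fun i j => hp (i, j)⟩
  refine ⟨min δ (1 / 2), by positivity, min_le_right _ _, fun L hL i j => ?_⟩
  obtain ⟨k, rfl⟩ := Nat.exists_eq_add_of_le hL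
  have hk := pow_mem hW k
  rw [pow_add, Matrix.mul_apply]
  calc min δ (1 / 2) ≤ δ := min_le_left _ _
    _ = ∑ x, δ * (W ^ k) x j := by
        rw [← Finset.mul_sum, sum_col_of_mem_doublyStochastic hk, mul_one]
    _ ≤ _ := Finset.sum_le_sum fun x _ =>
        mul_le_mul_of_nonneg_right (hδ i x) (nonneg_of_mem_doublyStochastic hk)

/-- The powers of a primitive doubly stochastic matrix converge geometrically to the averaging
matrix. This is Doeblin's argument: the columns of `W ^ L - 1 / N` sum to zero, so that
multiplying by `W ^ (d + 1)` is the same as multiplying by the nonnegative matrix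
`W ^ (d + 1) - δ`, whose row sums are `1 - N δ`. -/
theorem exists_pow_apply_sub_le (hW : W ∈ doublyStochastic ℝ (Fin N)) {d : ℕ} {δ : ℝ}
    (hδ0 : 0 < δ) (hδ1 : δ ≤ 1 / 2) (hδ : ∀ L, d ≤ L → ∀ i j, δ ≤ (W ^ L) i j) :
    ∃ c q : ℝ, 0 < c ∧ 0 < q ∧ q < 1 ∧ ∀ L i j, |(W ^ L) i j - 1 / N| ≤ c * q ^ L := by
  rcases Nat.eq_zero_or_pos N with rfl | hN
  · exact ⟨1, 1 / 2, one_pos, by norm_num, by norm_num, fun _ i => i.elim0⟩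
  have hN1 : (1 : ℝ) ≤ N := by exact_mod_cast hN
  have hN0 : (N : ℝ) ≠ 0 := by positivity
  -- The step is `d + 1` and not `d`, which may be zero.
  have hstep : ∀ a : ℝ, ∀ L, (∀ i j, |(W ^ L) i j - 1 / N| ≤ a) →
      ∀ i j, |(W ^ (d + 1 + L)) i j - 1 / N| ≤ (1 - δ) * a := by
    intro a L ha i j
    have ha0 : 0 ≤ a := (abs_nonneg _).trans (ha i j)
    have hL := pow_mem hW L
    have hd := pow_mem hW (d + 1)
    have hrow := sum_row_of_mem_doublyStochastic hd i
    have hcol := sum_col_of_mem_doublyStochastic hL j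
    have hsum : (W ^ (d + 1 + L)) i j - 1 / N
        = ∑ k, ((W ^ (d + 1)) i k - δ) * ((W ^ L) k j - 1 / N) := by
      simp only [sub_mul, mul_sub, Finset.sum_sub_distrib, ← Finset.sum_mul, ← Finset.mul_sum,
        hrow, hcol, pow_add W (d + 1) L, Matrix.mul_apply, Finset.sum_const, Finset.card_univ,
        Fintype.card_fin, nsmul_eq_mul]
      field_simp
      ring
    rw [hsum]
    calc |∑ k, ((W ^ (d + 1)) i k - δ) * ((W ^ L) k j - 1 / N)|
        ≤ ∑ k, |((W ^ (d + 1)) i k - δ) * ((W ^ L) k j - 1 / N)| :=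
          Finset.abs_sum_le_sum_abs _ _
      _ ≤ ∑ k, ((W ^ (d + 1)) i k - δ) * a := by
          refine Finset.sum_le_sum fun k _ => ?_
          have h0 : 0 ≤ (W ^ (d + 1)) i k - δ := sub_nonneg.2 (hδ _ (Nat.le_succ d) i k)
          rw [abs_mul, abs_of_nonneg h0]
          exact mul_le_mul_of_nonneg_left (ha k j) h0
      _ = (1 - N * δ) * a := by
          rw [← Finset.sum_mul, Finset.sum_sub_distrib, hrow]
          simp
      _ ≤ (1 - δ) * a := by
          refine mul_le_mul_of_nonneg_right ?_ ha0
          nlinarith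
  -- Bernoulli: this `q` satisfies `1 - δ ≤ q ^ (d + 1)`.
  set q : ℝ := 1 - δ / (d + 1) with hq
  have hd1 : (1 : ℝ) ≤ d + 1 := by linarith [(Nat.cast_nonneg d : (0 : ℝ) ≤ d)]
  have hx0 : 0 < δ / (d + 1) := by positivity
  have hx1 : δ / (d + 1) ≤ 1 / 2 := (div_le_self hδ0.le hd1).trans hδ1
  have hq0 : 0 < q := by linarith
  have hq1 : q < 1 := by linarith
  have hqd : 1 - δ ≤ q ^ (d + 1) := by
    have h := one_add_mul_le_pow (a := -(δ / (d + 1))) (by linarith) (d + 1)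
    have e : (1 : ℝ) + ((d + 1 : ℕ) : ℝ) * -(δ / (d + 1)) = 1 - δ := by
      push_cast
      field_simp
      ring
    rw [e, ← sub_eq_add_neg] at h
    exact h
  refine ⟨(q ^ (d + 1))⁻¹, q, by positivity, hq0, hq1, fun L => ?_⟩
  induction L using Nat.strong_induction_on with
  | _ L ih =>
    intro i j
    rcases lt_or_ge L (d + 1) with hL | hL
    · have h1 : (1 : ℝ) ≤ (q ^ (d + 1))⁻¹ * q ^ L := by
        rw [inv_mul_eq_div, one_le_div (by positivity)]
        exact pow_le_pow_of_le_one hq0.le hq1.le hL.le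
      refine le_trans ?_ h1
      have hm := pow_mem hW L
      have h2 : 0 ≤ (W ^ L) i j := nonneg_of_mem_doublyStochastic hm
      have h3 : (W ^ L) i j ≤ 1 := le_one_of_mem_doublyStochastic hm
      have h4 : (1 : ℝ) / N ≤ 1 := (div_le_one (by positivity)).2 hN1
      have h5 : (0 : ℝ) ≤ 1 / N := by positivity
      rw [abs_le]
      constructor <;> linarith
    · obtain ⟨k, rfl⟩ := Nat.exists_eq_add_of_le hL
      refine (hstep _ k (ih k (by omega)) i j).trans ?_
      rw [pow_add q (d + 1) k, mul_left_comm]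
      gcongr

end Consensus

/-! ### Mismatched covariances, and a norm bound from Loewner bounds -/

section Fusion

open Matrix
open scoped MatrixOrder

variable {N n : ℕ} {m : Fin N → ℕ}

theorem blockDiagonal'_posSemidef {X : ∀ j, Matrix (Fin (m j)) (Fin (m j)) ℝ}
    (hX : ∀ j, (X j).PosSemidef) : (blockDiagonal' X).PosSemidef := by
  refine PosSemidef.of_dotProduct_mulVec_nonneg ?_ fun v => ?_
  · rw [IsHermitian, blockDiagonal'_conjTranspose]
    congr 1
    funext j
    exact (hX j).isHermitian
  · have h : star v ⬝ᵥ blockDiagonal' X *ᵥ v =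
        ∑ j, (fun a => v ⟨j, a⟩) ⬝ᵥ X j *ᵥ (fun a => v ⟨j, a⟩) := by
      simp only [dotProduct, mulVec, Fintype.sum_sigma, star_trivial]
      refine Finset.sum_congr rfl fun j _ => Finset.sum_congr rfl fun a _ => ?_
      congr 1
      rw [Finset.sum_eq_single j]
      · simp [blockDiagonal'_apply_eq]
      · intro k _ hk
        simp [blockDiagonal'_apply_ne _ _ _ hk.symm]
      · simp
    rw [h]
    exact Finset.sum_nonneg fun j _ => by simpa using (hX j).dotProduct_mulVec_nonneg _

theorem blockDiagonal'_posDef {X : ∀ j, Matrix (Fin (m j)) (Fin (m j)) ℝ}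
    (hX : ∀ j, (X j).PosDef) : (blockDiagonal' X).PosDef := by
  refine (blockDiagonal'_posSemidef fun j => (hX j).posSemidef).posDef_iff_isUnit.2 ?_
  have hu := fun j => (Matrix.isUnit_iff_isUnit_det _).1 (hX j).isUnit
  refine IsUnit.of_mul_eq_one (blockDiagonal' fun j => (X j)⁻¹) ?_
  rw [← blockDiagonal'_mul, ← blockDiagonal'_one]
  congr 1
  funext j
  exact mul_nonsing_inv _ (hu j)

theorem modifiedC_eq_stackedC {W : Matrix (Fin N) (Fin N) ℝ}
    (C : ∀ j, Matrix (Fin (m j)) (Fin n) ℝ) {L : ℕ} {i : Fin N} (h : ∀ j, 0 < (W ^ L) i j) :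
    modifiedC W C L i = stackedC C := by
  simp [modifiedC, Real.sign_of_pos (h _)]

theorem modifiedR_posDef {W : Matrix (Fin N) (Fin N) ℝ}
    {R : ∀ j, Matrix (Fin (m j)) (Fin (m j)) ℝ} (hR : ∀ j, (R j).PosDef) {L : ℕ} {i : Fin N}
    (h : ∀ j, 0 < (W ^ L) i j) : (modifiedR W R L i).PosDef := by
  refine blockDiagonal'_posDef fun j => (hR j).smul ?_
  have hN : (0 : ℝ) < N := by exact_mod_cast i.pos
  have := h j
  positivity

theorem modifiedR_le_smul {W : Matrix (Fin N) (Fin N) ℝ}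
    {R : ∀ j, Matrix (Fin (m j)) (Fin (m j)) ℝ} (hR : ∀ j, (R j).PosDef) {L : ℕ} {i : Fin N}
    {s : ℝ} (hs : ∀ j, 1 / (N * (W ^ L) i j) ≤ s) : modifiedR W R L i ≤ s • collectiveR R := by
  rw [Matrix.le_iff, modifiedR, collectiveR, ← blockDiagonal'_smul, ← blockDiagonal'_sub]
  refine blockDiagonal'_posSemidef fun j => ?_
  simp only [Pi.sub_apply, Pi.smul_apply, ← sub_smul]
  exact (hR j).posSemidef.smul (sub_nonneg.2 (hs j))

theorem collectiveR_le_smul {W : Matrix (Fin N) (Fin N) ℝ}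
    {R : ∀ j, Matrix (Fin (m j)) (Fin (m j)) ℝ} (hR : ∀ j, (R j).PosDef) {L : ℕ} {i : Fin N}
    (h : ∀ j, 0 < (W ^ L) i j) {s : ℝ} (hs : ∀ j, N * (W ^ L) i j ≤ s) :
    collectiveR R ≤ s • modifiedR W R L i := by
  have hN : (0 : ℝ) < N := by exact_mod_cast i.pos
  rw [Matrix.le_iff, modifiedR, collectiveR, ← blockDiagonal'_smul, ← blockDiagonal'_sub]
  refine blockDiagonal'_posSemidef fun j => ?_
  have e : s • (1 / (N * (W ^ L) i j)) • R j - R j = (s * (1 / (N * (W ^ L) i j)) - 1) • R j := by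
    rw [sub_smul, smul_smul, one_smul]
  have hp : 0 < N * (W ^ L) i j := mul_pos hN (h j)
  simp only [Pi.sub_apply, Pi.smul_apply, e]
  refine (hR j).posSemidef.smul (sub_nonneg.2 ?_)
  rw [mul_one_div, one_le_div hp]
  exact hs j

theorem abs_apply_le_trace {X : Matrix (Fin n) (Fin n) ℝ} (hX : X.PosSemidef) (i j : Fin n) :
    |X i j| ≤ X.trace := by
  have hs : X j i = X i j := congrFun (congrFun (transpose_eq_of_posSemidef hX) i) j
  have hd : ∀ a, X a a ≤ X.trace := fun a =>
    Finset.single_le_sum (f := fun a => X a a) (fun b _ => hX.diag_nonneg) (Finset.mem_univ a)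
  have h1 := hX.dotProduct_mulVec_nonneg (Pi.single i 1 + Pi.single j 1)
  have h2 := hX.dotProduct_mulVec_nonneg (Pi.single i 1 - Pi.single j 1)
  simp only [star_trivial, mulVec_add, mulVec_sub, dotProduct_add, add_dotProduct, dotProduct_sub,
    sub_dotProduct, single_one_dotProduct, mulVec_single_one, col_apply, hs] at h1 h2
  have := hd i
  have := hd j
  rw [abs_le]
  constructor <;> linarith

theorem l2_opNorm_le_sum_single {X : Matrix (Fin n) (Fin n) ℝ} {a : ℝ} (hX : ∀ i j, |X i j| ≤ a) :
    ‖X‖ ≤ a * ∑ i : Fin n, ∑ j : Fin n, ‖Matrix.single i j (1 : ℝ)‖ := by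
  conv_lhs => rw [matrix_eq_sum_single X]
  rw [Finset.mul_sum]
  refine (norm_sum_le _ _).trans (Finset.sum_le_sum fun i _ => ?_)
  rw [Finset.mul_sum]
  refine (norm_sum_le _ _).trans (Finset.sum_le_sum fun j _ => ?_)
  have : Matrix.single i j (X i j) = X i j • Matrix.single i j (1 : ℝ) := by simp
  rw [this, norm_smul, Real.norm_eq_abs]
  exact mul_le_mul_of_nonneg_right (hX i j) (norm_nonneg _)

/-- Matrices within a factor `s` of each other in the Loewner order are close entrywise: write
`P - P'` as the difference of `(s - 1) P'` and `s P' - P`, both positive semidefinite, and bound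
their entries by their traces. -/
theorem abs_sub_apply_le {P P' : Matrix (Fin n) (Fin n) ℝ} (hP : P.PosSemidef)
    (hP' : P'.PosSemidef) {s : ℝ} (hs : 1 ≤ s) (h : P ≤ s • P') (h' : P' ≤ s • P) (i j : Fin n) :
    |(P - P') i j| ≤ (s - 1) * (2 * s + 1) * P.trace := by
  have h1 := abs_apply_le_trace (Matrix.le_iff.1 h) i j
  have h2 := abs_apply_le_trace hP' i j
  have h3 := (Matrix.le_iff.1 h').trace_nonneg
  have h4 := hP.trace_nonneg
  simp only [trace_sub, trace_smul, smul_eq_mul, Matrix.sub_apply, Matrix.smul_apply] at h1 h3 ⊢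
  have e : P i j - P' i j = (s - 1) * P' i j - (s * P' i j - P i j) := by ring
  rw [e]
  calc |(s - 1) * P' i j - (s * P' i j - P i j)|
      ≤ |(s - 1) * P' i j| + |s * P' i j - P i j| := abs_sub _ _
    _ ≤ (s - 1) * P'.trace + (s * P'.trace - P.trace) := by
        rw [abs_mul, abs_of_nonneg (sub_nonneg.2 hs)]
        gcongr
    _ ≤ (s - 1) * (s * P.trace) + (s * (s * P.trace) - P.trace) := by
        have : P'.trace ≤ s * P.trace := by linarith
        gcongr
    _ = _ := by ring

end Fusion

/-! ### Solvability of the Riccati equation -/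

theorem Observable.existsUnique_isDareSolution {n : ℕ} {p : Type*} [Fintype p] [DecidableEq p]
    {A Q : Matrix (Fin n) (Fin n) ℝ} {C : Matrix p (Fin n) ℝ} {R : Matrix p p ℝ}
    (hobs : Observable A C) (hQ : Q.PosDef) (hR : R.PosDef) :
    ∃! P, IsDareSolution A C Q R P := by
  obtain ⟨P, hP⟩ := hobs.exists_riccati_fixedPoint hQ.posSemidef hR
  have hle : ∀ {X Y}, IsDareSolution A C Q R X → IsDareSolution A C Q R Y → (Y - X).PosSemidef := by
    intro X Y hX hY
    have h := riccati_fixedPoint_le_smul hQ hR hR hX.1 hY.1 hX.2 hY.2 le_rfl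
      (by rw [Matrix.le_iff]; simpa using Matrix.PosSemidef.zero)
    simpa [Matrix.le_iff] using h
  exact ⟨P, hP, fun Y hY => by
    open scoped MatrixOrder in
    exact le_antisymm (Matrix.le_iff.2 (hle hY hP)) (Matrix.le_iff.2 (hle hP hY))⟩

end CMFusion

theorem theorem2 {N n : ℕ} {m : Fin N → ℕ}
    (W : Matrix (Fin N) (Fin N) ℝ)
    (hW : W ∈ doublyStochastic ℝ (Fin N))
    (hdiag : ∀ i, 0 < W i i)
    (hconn : CMFusion.StronglyConnected W)
    (A : Matrix (Fin n) (Fin n) ℝ)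
    (C : ∀ j, Matrix (Fin (m j)) (Fin n) ℝ)
    (Q : Matrix (Fin n) (Fin n) ℝ)
    (R : ∀ j, Matrix (Fin (m j)) (Fin (m j)) ℝ)
    (hQ : Q.PosDef)
    (hR : ∀ j, (R j).PosDef)
    (hobs : CMFusion.Observable A (CMFusion.stackedC C)) :
    (∃! P, CMFusion.IsDareSolution A (CMFusion.stackedC C) Q (CMFusion.collectiveR R) P) ∧
    (∀ i : Fin N, ∀ L : ℕ, CMFusion.graphDiam W ≤ L →
      ∃! P', CMFusion.IsDareSolution A (CMFusion.modifiedC W C L i) Q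
        (CMFusion.modifiedR W R L i) P') ∧
    ∃ M₁ q₁ : ℝ, 0 < M₁ ∧ 0 < q₁ ∧ q₁ < 1 ∧
      ∀ P, CMFusion.IsDareSolution A (CMFusion.stackedC C) Q (CMFusion.collectiveR R) P →
        ∀ i : Fin N, ∀ L : ℕ, CMFusion.graphDiam W ≤ L →
          ∀ P', CMFusion.IsDareSolution A (CMFusion.modifiedC W C L i) Q
              (CMFusion.modifiedR W R L i) P' →
            ‖P - P'‖ ≤ M₁ * q₁ ^ L := by
  open CMFusion in
  have hRpd : (collectiveR R).PosDef := blockDiagonal'_posDef hR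
  have hpos : ∀ L, graphDiam W ≤ L → ∀ i j, 0 < (W ^ L) i j := fun L hL i j =>
    (hconn.hasWalk hdiag hL i j).pow_pos hW
  have huniq := hobs.existsUnique_isDareSolution hQ hRpd
  refine ⟨huniq, fun i L hL => ?_, ?_⟩
  · rw [modifiedC_eq_stackedC C (hpos L hL i)]
    exact hobs.existsUnique_isDareSolution hQ (modifiedR_posDef hR (hpos L hL i))
  obtain ⟨δ, hδ0, hδ1, hδ⟩ := exists_pow_apply_lower_bound hW (hpos _ le_rfl)
  obtain ⟨c, q, hc, hq0, hq1, hq⟩ := exists_pow_apply_sub_le hW hδ0 hδ1 hδ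
  obtain ⟨P₀, hP₀, hP₀u⟩ := huniq
  set κ : ℝ := N * c + c / δ
  have hκ0 : 0 ≤ κ := by positivity
  set T : ℝ := ∑ i : Fin n, ∑ j : Fin n, ‖Matrix.single i j (1 : ℝ)‖
  have hT0 : 0 ≤ T := by positivity
  have htr := hP₀.1.trace_nonneg
  refine ⟨κ * (2 * (1 + κ) + 1) * P₀.trace * T + 1, q, by positivity, hq0, hq1, ?_⟩
  intro P hP i L hL P' hP'
  obtain rfl := hP₀u P hP
  rw [modifiedC_eq_stackedC C (hpos L hL i)] at hP'
  have hN : (0 : ℝ) < N := by exact_mod_cast i.pos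
  have hqL : 0 < q ^ L := pow_pos hq0 L
  have hqL1 : q ^ L ≤ 1 := pow_le_one₀ hq0.le hq1.le
  -- `s` bounds both `N l` and `1 / (N l)` for every weight `l` of node `i` after `L` steps.
  set s : ℝ := 1 + κ * q ^ L with hs
  have hs1 : 1 ≤ s := by
    have := mul_nonneg hκ0 hqL.le
    linarith
  have hup : ∀ j, N * (W ^ L) i j ≤ s := by
    intro j
    have h1 := (abs_le.1 (hq L i j)).2
    have h2 : N * (W ^ L) i j = 1 + N * ((W ^ L) i j - 1 / N) := by field_simp; ring
    have h3 : N * ((W ^ L) i j - 1 / N) ≤ N * (c * q ^ L) := by gcongr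
    have h4 : κ * q ^ L = N * (c * q ^ L) + c / δ * q ^ L := by ring
    have h5 : 0 ≤ c / δ * q ^ L := by positivity
    linarith
  have hlow : ∀ j, 1 / (N * (W ^ L) i j) ≤ s := by
    intro j
    have hw := hpos L hL i j
    have h1 := (abs_le.1 (hq L i j)).1
    have h2 : 1 / (N * (W ^ L) i j) = 1 + (1 / N - (W ^ L) i j) / (W ^ L) i j := by
      field_simp; ring
    have h3 : (1 / N - (W ^ L) i j) / (W ^ L) i j ≤ (c * q ^ L) / δ := by
      have h6 := hδ L hL i j
      gcongr
      linarith
    have h4 : κ * q ^ L = N * (c * q ^ L) + c * q ^ L / δ := by ring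
    have h5 : 0 ≤ N * (c * q ^ L) := by positivity
    linarith
  have hR' := modifiedR_posDef hR (hpos L hL i)
  have hle := riccati_fixedPoint_le_smul hQ hRpd hR' hP.1 hP'.1 hP.2 hP'.2 hs1
    (collectiveR_le_smul hR (hpos L hL i) hup)
  have hle' := riccati_fixedPoint_le_smul hQ hR' hRpd hP'.1 hP.1 hP'.2 hP.2 hs1
    (modifiedR_le_smul hR hlow)
  refine (l2_opNorm_le_sum_single (abs_sub_apply_le hP.1 hP'.1 hs1 hle hle')).trans ?_
  have e1 : (s - 1) = κ * q ^ L := by rw [hs]; ring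
  have e2 : s ≤ 1 + κ := by
    have := mul_le_mul_of_nonneg_left hqL1 hκ0
    linarith
  rw [e1]
  calc κ * q ^ L * (2 * s + 1) * P.trace * T
      ≤ κ * q ^ L * (2 * (1 + κ) + 1) * P.trace * T := by gcongr
    _ = κ * (2 * (1 + κ) + 1) * P.trace * T * q ^ L := by ring
    _ ≤ _ := by
        rw [add_mul]
        linarith
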